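/- Let $R$ be a commutative unital ring in which $2$ is invertible. Let $\mathcal C$ be the $R$-linear category whose objects are the numbered virtual tangle diagrams with four boundary points and without classical crossings (finitely many numbered v-strings and v-circles), and whose morphisms are the $R$-linear combinations of open cobordisms with boundary decorations: abstract surfaces generated by disjoint unions of the elementary cobordisms (cylinders and strips, births, deaths, multiplications, comultiplications and saddles involving strings), where every horizontal boundary piece carries a gluing number $\pm$ and every component carries an indicator $\pm1$ and finitely many dots. Composition is gluing (indicators are multiplied). A composite whose gluing numbers cannot be matched by reversing all gluing numbers of some components is zero (non-orientable case, indicator $0$). Reversing all gluing numbers of a component with indicator $\epsilon$ and $n$ dots multiplies the surface by $\epsilon(-1)^n$. Lee's dot relations hold: two dots on a component cancel, a sphere is $0$, a sphere with one dot is $1$, and a neck is cut into the sum of the two surfaces with one dot on one of the two sides (so a handle is twice a dot). For a piece $x$ of an object let $\mathrm d_x=\tfrac12(\mathrm{Id}+\mathrm{dot}_x)$ ("down") and $\mathrm u_x=\tfrac12(\mathrm{Id}-\mathrm{dot}_x)$ ("up"); these are orthogonal idempotents with $\mathrm d_x+\mathrm u_x=\mathrm{Id}$. Let $V$ be the smoothing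 $)($ of a crossing, with standard orientations left string down and right string up, and let $H$ be the other smoothing, with standard orientations bottom string to the right and top string to the left. For $l,r,b,t\in\{+,-\}$ let $S(1)^{lr}_{bt}\colon V\to H$ and $S(1)^{bt}_{lr}\colon H\to V$ be the saddles with indicator $+1$ and gluing numbers $l,r$ on the left and right string and $b,t$ on the bottom and top string. Let $$[\![\text{positive crossing}]\!]^{lr}_{bt}=\bigl(V\xrightarrow{S(1)^{lr}_{bt}}H\bigr),\qquad [\![\text{negative crossing}]\!]^{bt}_{lr}=\bigl(H\xrightarrow{S(1)^{bt}_{lr}}V\bigr)$$ in homological degrees $0,1$ and $-1,0$ respectively. For $p,q\in\{\mathrm d,\mathrm u\}$ let $V_{pq}$ be the object of the Karoubi envelope $\mathrm{Kar}(\mathcal C)$ that is the image of the idempotent with colour $p$ on the left and $q$ on the right string, and let $H_{pq}$ be the image of the idempotent with colour $p$ on the bottom and $q$ on the top string. Put $$V^{lr}=\begin{cases}V_{\mathrm{du}}\oplus V_{\mathrm{ud}}&\text{if }l=r,\\ V_{\mathrm{dd}}\oplus V_{\mathrm{uu}}&\text{if }l\neq r,\end{cases}\qquad H^{bt}=\begin{cases}H_{\mathrm{du}}\oplus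 H_{\mathrm{ud}}&\text{if }b=t,\\ H_{\mathrm{dd}}\oplus H_{\mathrm{uu}}&\text{if }b\neq t.\end{cases}$$ Theorem. For each of the sixteen choices of $l,r,b,t\in\{+,-\}$ there are homotopy equivalences of cochain complexes of formal matrices over $\mathrm{Kar}(\mathcal C)$ $$[\![\text{positive crossing}]\!]^{lr}_{bt}\simeq\bigl(V^{lr}\xrightarrow{\,0\,}H^{bt}\bigr),\qquad [\![\text{negative crossing}]\!]^{bt}_{lr}\simeq\bigl(H^{bt}\xrightarrow{\,0\,}V^{lr}\bigr),$$ in degrees $0,1$ and $-1,0$ respectively. -/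

import Mathlib

open CategoryTheory CategoryTheory.Limits

noncomputable section

namespace VKh

/-! ### Objects -/

/-- A numbered virtual tangle diagram with `k` boundary points and without classical crossings.
It consists of numbered pieces; `ends i` is the number of the piece that contains the boundary
point `i`.  A piece containing two boundary points is a v-string, a piece containing none is a
v-circle.  (Virtual crossings carry no further information: cobordisms are abstract surfaces, and
such a diagram is determined by these data up to the virtual Reidemeister moves, which induce
isomorphisms.)  Every piece has a fixed standard orientation; gluing numbers are relative to it. -/
structure VTangle (k : ℕ) where
  pieces : ℕ
  ends : Fin k → Fin pieces
  card_ends : ∀ x, (Finset.univ.filter fun i => ends i = x).card = 0 ∨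
    (Finset.univ.filter fun i => ends i = x).card = 2

variable {k : ℕ}

/-- The piece `x` is a v-string (otherwise it is a v-circle). -/
def VTangle.IsString (a : VTangle k) (x : Fin a.pieces) : Prop := ∃ i, a.ends i = x

instance (a : VTangle k) (x : Fin a.pieces) : Decidable (a.IsString x) :=
  inferInstanceAs (Decidable (∃ i, a.ends i = x))

/-! ### Decorated surfaces -/

/-- An abstract surface from `a` (top) to `b` (bottom), up to homeomorphism relative to the
boundary, with its decorations and dots.  The components are numbered; `pos` is the component
containing a given top (`Sum.inl`) or bottom (`Sum.inr`) boundary piece.  Strings of `a` and `b`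
that share a boundary point are joined by a vertical boundary line, hence lie on the same
component.  Every component has an Euler characteristic, an indicator `±1` and a number of dots,
and every horizontal boundary piece has a gluing number `±1`.  (The gluing numbers play the role of
an orientation.  Surfaces with indicator `0` are zero since `2` is invertible, so they are left
out.) -/
structure Surface (a b : VTangle k) where
  comps : ℕ
  pos : Fin a.pieces ⊕ Fin b.pieces → Fin comps
  seam : ∀ i, pos (Sum.inl (a.ends i)) = pos (Sum.inr (b.ends i))
  euler : Fin comps → ℤ
  sign : Fin a.pieces ⊕ Fin b.pieces → ℤˣ
  ind : Fin comps → ℤˣ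
  dots : Fin comps → ℕ

namespace Surface

variable {a b c : VTangle k}

/-- The top boundary pieces of a component. -/
def top (F : Surface a b) (z : Fin F.comps) : Set (Fin a.pieces) :=
  {x | F.pos (Sum.inl x) = z}

/-- The bottom boundary pieces of a component. -/
def bot (F : Surface a b) (z : Fin F.comps) : Set (Fin b.pieces) :=
  {y | F.pos (Sum.inr y) = z}

/-- The component `z` of `F` is one of the generating cobordisms (with arbitrary gluing numbers,
i.e. up to composition with `Φ`, and with any number of dots):
cylinder over a circle (`Id`, `Φ`), strip over a string (`Id(±1)`, `Φ(±1)`), birth `ι`, death `ε`,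
multiplication `m`, comultiplication `Δ`, the two saddles between a string and a string with a
circle, and the saddle `S(±1)` between two strings and two strings.  Without strings the indicator
is the type of the generator, i.e. the sign in its relation under reversal of all gluing numbers;
with strings both indicators occur. -/
inductive IsGenerator (F : Surface a b) (z : Fin F.comps) : Prop
  | cylinder (x : Fin a.pieces) (y : Fin b.pieces) (hx : ¬ a.IsString x) (hy : ¬ b.IsString y)
      (ht : F.top z = {x}) (hb : F.bot z = {y}) (he : F.euler z = 0) (hi : F.ind z = 1)
  | strip (x : Fin a.pieces) (y : Fin b.pieces) (hx : a.IsString x) (hy : b.IsString y)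
      (ht : F.top z = {x}) (hb : F.bot z = {y}) (he : F.euler z = 1)
  | birth (y : Fin b.pieces) (hy : ¬ b.IsString y)
      (ht : F.top z = ∅) (hb : F.bot z = {y}) (he : F.euler z = 1) (hi : F.ind z = 1)
  | death (x : Fin a.pieces) (hx : ¬ a.IsString x)
      (ht : F.top z = {x}) (hb : F.bot z = ∅) (he : F.euler z = 1) (hi : F.ind z = -1)
  | mult (x x' : Fin a.pieces) (y : Fin b.pieces) (hxx : x ≠ x') (hx : ¬ a.IsString x)
      (hx' : ¬ a.IsString x') (hy : ¬ b.IsString y)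
      (ht : F.top z = {x, x'}) (hb : F.bot z = {y}) (he : F.euler z = -1) (hi : F.ind z = 1)
  | comult (x : Fin a.pieces) (y y' : Fin b.pieces) (hyy : y ≠ y') (hx : ¬ a.IsString x)
      (hy : ¬ b.IsString y) (hy' : ¬ b.IsString y')
      (ht : F.top z = {x}) (hb : F.bot z = {y, y'}) (he : F.euler z = -1) (hi : F.ind z = -1)
  | absorb (x x' : Fin a.pieces) (y : Fin b.pieces) (hx : a.IsString x)
      (hx' : ¬ a.IsString x') (hy : b.IsString y)
      (ht : F.top z = {x, x'}) (hb : F.bot z = {y}) (he : F.euler z = 0)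
  | emit (x : Fin a.pieces) (y y' : Fin b.pieces) (hx : a.IsString x)
      (hy : b.IsString y) (hy' : ¬ b.IsString y')
      (ht : F.top z = {x}) (hb : F.bot z = {y, y'}) (he : F.euler z = 0)
  | saddle (x x' : Fin a.pieces) (y y' : Fin b.pieces) (hxx : x ≠ x') (hyy : y ≠ y')
      (hx : a.IsString x) (hx' : a.IsString x') (hy : b.IsString y) (hy' : b.IsString y')
      (hreconnect : ∃ i j, a.ends i = x ∧ a.ends j = x ∧ b.ends i = y ∧ b.ends j = y')
      (ht : F.top z = {x, x'}) (hb : F.bot z = {y, y'}) (he : F.euler z = 1)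

/-- The components of `F` and `G` that meet along a piece of the middle tangle. -/
inductive Adjacent (F : Surface a b) (G : Surface b c) :
    Fin F.comps ⊕ Fin G.comps → Fin F.comps ⊕ Fin G.comps → Prop
  | mk (y : Fin b.pieces) :
      Adjacent F G (Sum.inl (F.pos (Sum.inr y))) (Sum.inr (G.pos (Sum.inl y)))

/-- `H` is obtained by gluing `F` and `G` along `b`, where the gluing numbers along `b` match; `p`
and `q` send a component of `F` resp. `G` to the component of `H` that contains it.  The Euler
characteristic of a circle is `0` and that of a string is `1`; indicators are multiplied. -/
structure IsGluing (F : Surface a b) (G : Surface b c) (H : Surface a c)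
    (p : Fin F.comps → Fin H.comps) (q : Fin G.comps → Fin H.comps) : Prop where
  sign_match : ∀ y, F.sign (Sum.inr y) = G.sign (Sum.inl y)
  glued : ∀ y, p (F.pos (Sum.inr y)) = q (G.pos (Sum.inl y))
  surj : ∀ z, (∃ u, p u = z) ∨ ∃ v, q v = z
  connected : ∀ u v : Fin F.comps ⊕ Fin G.comps,
    Sum.elim p q u = Sum.elim p q v → Relation.EqvGen (Adjacent F G) u v
  pos_top : ∀ x, H.pos (Sum.inl x) = p (F.pos (Sum.inl x))
  pos_bot : ∀ y, H.pos (Sum.inr y) = q (G.pos (Sum.inr y))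
  sign_top : ∀ x, H.sign (Sum.inl x) = F.sign (Sum.inl x)
  sign_bot : ∀ y, H.sign (Sum.inr y) = G.sign (Sum.inr y)
  euler : ∀ z, H.euler z =
    (∑ u, if p u = z then F.euler u else 0) + (∑ v, if q v = z then G.euler v else 0)
      - ∑ y, if b.IsString y ∧ p (F.pos (Sum.inr y)) = z then 1 else 0
  ind : ∀ z, H.ind z =
    (∏ u, if p u = z then F.ind u else 1) * ∏ v, if q v = z then G.ind v else 1
  dots : ∀ z, H.dots z =
    (∑ u, if p u = z then F.dots u else 0) + ∑ v, if q v = z then G.dots v else 0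

/-- The morphisms are the surfaces generated by disjoint unions of the generating cobordisms. -/
inductive Generated : {a b : VTangle k} → Surface a b → Prop
  | elementary {a b : VTangle k} (F : Surface a b) (h : ∀ z, F.IsGenerator z) : Generated F
  | glue {a b c : VTangle k} (F : Surface a b) (G : Surface b c) (H : Surface a c)
      (hF : Generated F) (hG : Generated G) (p : Fin F.comps → Fin H.comps)
      (q : Fin G.comps → Fin H.comps) (h : IsGluing F G H p q) : Generated H

/-- The gluing numbers of `F` and `G` along `b` cannot be made to match by reversing all gluing
numbers of some components, i.e. the glued surface is non-orientable (has indicator `0`). -/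
def Mismatch (F : Surface a b) (G : Surface b c) : Prop :=
  ¬ ∃ (s : Fin F.comps → ℤˣ) (t : Fin G.comps → ℤˣ), ∀ y,
    s (F.pos (Sum.inr y)) * F.sign (Sum.inr y) = t (G.pos (Sum.inl y)) * G.sign (Sum.inl y)

/-- `F` and `G` are homeomorphic relative to the boundary, with the same decorations. -/
structure IsHomeo (F G : Surface a b) (e : Fin F.comps ≃ Fin G.comps) : Prop where
  pos : ∀ x, G.pos x = e (F.pos x)
  sign : ∀ x, G.sign x = F.sign x
  euler : ∀ z, G.euler (e z) = F.euler z
  ind : ∀ z, G.ind (e z) = F.ind z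
  dots : ∀ z, G.dots (e z) = F.dots z

/-- Reverse all gluing numbers of the component `z`. -/
abbrev flip (F : Surface a b) (z : Fin F.comps) : Surface a b :=
  { F with sign := fun x => if F.pos x = z then - F.sign x else F.sign x }

/-- Put `n` additional dots on the component `z`. -/
abbrev addDots (F : Surface a b) (z : Fin F.comps) (n : ℕ) : Surface a b :=
  { F with dots := F.dots + Pi.single z n }

/-- Add a handle, i.e. a multiplication after a comultiplication, to the component `z`. -/
abbrev addHandle (F : Surface a b) (z : Fin F.comps) : Surface a b :=
  { F with
    euler := F.euler - Pi.single z 2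
    ind := Function.update F.ind z (- F.ind z) }

/-- `F` is obtained from `G` by connecting the different components `z₁` and `z₂` by a tube, i.e. by
gluing in a multiplication followed by a comultiplication along two discs. -/
structure IsTube (F G : Surface a b) (z₁ z₂ : Fin G.comps) (p : Fin G.comps → Fin F.comps) :
    Prop where
  ne : z₁ ≠ z₂
  surj : Function.Surjective p
  fibre : ∀ u v, p u = p v ↔ u = v ∨ (u = z₁ ∧ v = z₂) ∨ (u = z₂ ∧ v = z₁)
  pos : ∀ x, F.pos x = p (G.pos x)
  sign : ∀ x, F.sign x = G.sign x
  euler : F.euler (p z₁) = G.euler z₁ + G.euler z₂ - 2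
  ind : F.ind (p z₁) = - (G.ind z₁ * G.ind z₂)
  dots : F.dots (p z₁) = G.dots z₁ + G.dots z₂
  euler_other : ∀ u, u ≠ z₁ → u ≠ z₂ → F.euler (p u) = G.euler u
  ind_other : ∀ u, u ≠ z₁ → u ≠ z₂ → F.ind (p u) = G.ind u
  dots_other : ∀ u, u ≠ z₁ → u ≠ z₂ → F.dots (p u) = G.dots u

/-- The component `z` is a sphere (closed, of Euler characteristic `2`). -/
structure IsSphere (F : Surface a b) (z : Fin F.comps) : Prop where
  closed : ∀ x, F.pos x ≠ z
  euler : F.euler z = 2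
  ind : F.ind z = -1

/-- `G` is obtained from `F` by removing the closed component `z`; `p` is the inclusion of the
remaining components. -/
structure IsRemoval (F G : Surface a b) (z : Fin F.comps) (p : Fin G.comps → Fin F.comps) :
    Prop where
  inj : Function.Injective p
  range : ∀ u, u ≠ z ↔ ∃ v, p v = u
  pos : ∀ x, F.pos x = p (G.pos x)
  sign : ∀ x, F.sign x = G.sign x
  euler : ∀ u, F.euler (p u) = G.euler u
  ind : ∀ u, F.ind (p u) = G.ind u
  dots : ∀ u, F.dots (p u) = G.dots u

/-- The identity cobordism with `n x` dots on the piece `x`. -/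
abbrev dotted (a : VTangle k) (n : Fin a.pieces → ℕ) : Surface a a where
  comps := a.pieces
  pos := Sum.elim id id
  seam _ := rfl
  euler x := if a.IsString x then 1 else 0
  sign _ := 1
  ind _ := 1
  dots := n

theorem dotted_generated (a : VTangle k) (n : Fin a.pieces → ℕ) : (dotted a n).Generated := by
  refine .elementary _ fun z => ?_
  have ht : (dotted a n).top z = {z} := by
    rfl
  have hb : (dotted a n).bot z = {z} := by
    rfl
  by_cases hz : a.IsString z
  · exact .strip z z hz hz ht hb (if_pos hz)
  · exact .cylinder z z hz hz ht hb (if_neg hz) rfl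

theorem dotted_isGluing (a : VTangle k) (m n : Fin a.pieces → ℕ) :
    IsGluing (dotted a m) (dotted a n) (dotted a (m + n)) id id where
  sign_match _ := rfl
  glued _ := rfl
  surj z := Or.inl ⟨z, rfl⟩
  connected := by
    have key : ∀ y : Fin a.pieces, Relation.EqvGen (Adjacent (dotted a m) (dotted a n))
        (Sum.inl y) (Sum.inr y) := fun y => .rel _ _ (Adjacent.mk y)
    rintro (u | u) (v | v) h <;> obtain rfl : u = v := h
    · exact .refl _
    · exact key u
    · exact .symm _ _ (key u)
    · exact .refl _
  pos_top _ := rfl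
  pos_bot _ := rfl
  sign_top _ := rfl
  sign_bot _ := rfl
  euler z := by
    change (if a.IsString z then (1 : ℤ) else 0) =
      (∑ u : Fin a.pieces, if u = z then (if a.IsString u then (1 : ℤ) else 0) else 0) +
      (∑ u : Fin a.pieces, if u = z then (if a.IsString u then (1 : ℤ) else 0) else 0) -
      ∑ y : Fin a.pieces, if a.IsString y ∧ y = z then 1 else 0
    simp only [Finset.sum_ite_eq', Finset.mem_univ, if_true, and_comm (b := _ = z), ite_and]
    ring
  ind z := by
    change (1 : ℤˣ) = (∏ u : Fin a.pieces, if u = z then 1 else 1) *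
      ∏ u : Fin a.pieces, if u = z then 1 else 1
    simp
  dots z := by
    change m z + n z = (∑ u : Fin a.pieces, if u = z then m u else 0) +
      ∑ u : Fin a.pieces, if u = z then n u else 0
    simp

end Surface

/-! ### The category of decorated cobordisms modulo the dot relations -/

instance : Quiver (VTangle k) where
  Hom a b := { F : Surface a b // F.Generated }

variable (R : Type*) [CommRing R]

/-- Formal `R`-linear combinations of composable words of surfaces. -/
abbrev Word (k : ℕ) := Free R (Paths (VTangle k))

/-- A surface as a word of length one. -/
def Word.of {a b : VTangle k} (F : Surface a b) (h : F.Generated) :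
    (show Word R k from a) ⟶ (show Word R k from b) :=
  Finsupp.single (Quiver.Hom.toPath (show (a ⟶ b) from ⟨F, h⟩)) 1

open Surface in
/-- The relations of the category of open cobordisms with boundary decorations, together with
the dot relations of Lee's variant; the last six constructors close them to a linear congruence. -/
inductive Rel : {X Y : Word R k} → (X ⟶ Y) → (X ⟶ Y) → Prop
  /- The undotted cylinder is the identity. -/
  | cylinder (a : VTangle k) :
      Rel (Word.of R (dotted a 0) (dotted_generated a 0)) (𝟙 (show Word R k from a))
  /- Homeomorphic surfaces are equal. -/
  | homeo {a b : VTangle k} (F G : Surface a b) (hF : F.Generated) (hG : G.Generated)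
      (e : Fin F.comps ≃ Fin G.comps) (h : IsHomeo F G e) :
      Rel (Word.of R F hF) (Word.of R G hG)
  /- Composition is gluing. -/
  | glue {a b c : VTangle k} (F : Surface a b) (G : Surface b c) (H : Surface a c)
      (hF : F.Generated) (hG : G.Generated) (hH : H.Generated) (p : Fin F.comps → Fin H.comps)
      (q : Fin G.comps → Fin H.comps) (h : IsGluing F G H p q) :
      Rel (Word.of R F hF ≫ Word.of R G hG) (Word.of R H hH)
  /- Surfaces with indicator `0` vanish. -/
  | mismatch {a b c : VTangle k} (F : Surface a b) (G : Surface b c)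
      (hF : F.Generated) (hG : G.Generated) (h : Mismatch F G) :
      Rel (Word.of R F hF ≫ Word.of R G hG) 0
  /- Reversing all gluing numbers of a component multiplies with its indicator, and with
  a further `-1` for every dot. -/
  | flip {a b : VTangle k} (F : Surface a b) (z : Fin F.comps) (hF : F.Generated)
      (hF' : (F.flip z).Generated) :
      Rel (Word.of R F hF) ((((F.ind z * (-1) ^ F.dots z : ℤˣ) : ℤ) : R) • Word.of R (F.flip z) hF')
  /- Two dots on a component cancel. -/
  | dot_sq {a b : VTangle k} (F : Surface a b) (z : Fin F.comps) (hF : F.Generated)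
      (hF' : (F.addDots z 2).Generated) :
      Rel (Word.of R (F.addDots z 2) hF') (Word.of R F hF)
  /- Neck cutting, non-separating case: a handle is two times a dot. -/
  | handle {a b : VTangle k} (F : Surface a b) (z : Fin F.comps)
      (h : (F.addHandle z).Generated) (h' : (F.addDots z 1).Generated) :
      Rel (Word.of R (F.addHandle z) h) ((2 : R) • Word.of R (F.addDots z 1) h')
  /- Neck cutting, separating case. -/
  | neck {a b : VTangle k} (F G : Surface a b) (z₁ z₂ : Fin G.comps)
      (p : Fin G.comps → Fin F.comps) (h : IsTube F G z₁ z₂ p) (hF : F.Generated)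
      (h₁ : (G.addDots z₁ 1).Generated) (h₂ : (G.addDots z₂ 1).Generated) :
      Rel (Word.of R F hF) (Word.of R (G.addDots z₁ 1) h₁ + Word.of R (G.addDots z₂ 1) h₂)
  /- A sphere is zero. -/
  | sphere {a b : VTangle k} (F : Surface a b) (z : Fin F.comps) (hz : IsSphere F z)
      (hd : F.dots z = 0) (hF : F.Generated) : Rel (Word.of R F hF) 0
  /- A sphere with one dot is one. -/
  | dotted_sphere {a b : VTangle k} (F G : Surface a b) (z : Fin F.comps) (hz : IsSphere F z)
      (hd : F.dots z = 1) (p : Fin G.comps → Fin F.comps) (h : IsRemoval F G z p)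
      (hF : F.Generated) (hG : G.Generated) : Rel (Word.of R F hF) (Word.of R G hG)
  | refl {X Y : Word R k} (f : X ⟶ Y) : Rel f f
  | symm {X Y : Word R k} {f g : X ⟶ Y} (h : Rel f g) : Rel g f
  | trans {X Y : Word R k} {f g h : X ⟶ Y} (h₁ : Rel f g) (h₂ : Rel g h) : Rel f h
  | comp {X Y Z : Word R k} {f f' : X ⟶ Y} {g g' : Y ⟶ Z} (h₁ : Rel f f') (h₂ : Rel g g') :
      Rel (f ≫ g) (f' ≫ g')
  | add {X Y : Word R k} {f f' g g' : X ⟶ Y} (h₁ : Rel f f') (h₂ : Rel g g') :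
      Rel (f + g) (f' + g')
  | smul {X Y : Word R k} {f f' : X ⟶ Y} (r : R) (h : Rel f f') : Rel (r • f) (r • f')

/-- The relation as a relation on all morphism sets. -/
def rel (k : ℕ) : HomRel (Word R k) := fun _ _ f g => Rel R f g

instance : Congruence (rel R k) where
  equivalence := ⟨.refl, .symm, .trans⟩
  comp_left _ _ _ h := .comp (.refl _) h
  comp_right _ h := .comp h (.refl _)

/-- The `R`-linear category of v-tangles with `k` boundary points without classical crossings and of
open cobordisms with boundary decorations, modulo the dot relations of Lee's variant. -/
abbrev Cob (k : ℕ) := CategoryTheory.Quotient (rel R k)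

instance : Preadditive (Cob R k) :=
  CategoryTheory.Quotient.preadditive (rel R k) fun _ _ _ _ _ _ h h' => .add h h'

instance : (CategoryTheory.Quotient.functor (rel R k)).Additive :=
  CategoryTheory.Quotient.functor_additive (rel R k) fun _ _ _ _ _ _ h h' => .add h h'

instance : Linear R (Cob R k) :=
  CategoryTheory.Quotient.linear R (rel R k) fun r _ _ _ _ h => .smul r h

instance : (CategoryTheory.Quotient.functor (rel R k)).Linear R :=
  CategoryTheory.Quotient.linear_functor R (rel R k) fun r _ _ _ _ h => .smul r h

/-- A v-tangle as an object of the cobordism category. -/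
def obj (a : VTangle k) : Cob R k := (CategoryTheory.Quotient.functor (rel R k)).obj a

/-- The morphism given by a surface. -/
def mor {a b : VTangle k} (F : Surface a b) (h : F.Generated) : obj R a ⟶ obj R b :=
  (CategoryTheory.Quotient.functor (rel R k)).map (Word.of R F h)

/-- The identity of `a` with dots. -/
def dottedId (a : VTangle k) (n : Fin a.pieces → ℕ) : obj R a ⟶ obj R a :=
  mor R (Surface.dotted a n) (Surface.dotted_generated a n)

/-- The identity of `a` with one dot on the piece `x`. -/
def dot (a : VTangle k) (x : Fin a.pieces) : obj R a ⟶ obj R a := dottedId R a (Pi.single x 1)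

theorem dottedId_zero (a : VTangle k) : dottedId R a 0 = 𝟙 (obj R a) := by
  refine (CategoryTheory.Quotient.sound (rel R k) (Rel.cylinder a)).trans ?_
  exact (CategoryTheory.Quotient.functor (rel R k)).map_id _

theorem dottedId_comp (a : VTangle k) (m n : Fin a.pieces → ℕ) :
    dottedId R a m ≫ dottedId R a n = dottedId R a (m + n) := by
  refine ((CategoryTheory.Quotient.functor (rel R k)).map_comp _ _).symm.trans ?_
  exact CategoryTheory.Quotient.sound (rel R k)
    (Rel.glue _ _ _ _ _ _ _ _ (Surface.dotted_isGluing a m n))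

theorem dot_comp_self (a : VTangle k) (x : Fin a.pieces) : dot R a x ≫ dot R a x = 𝟙 _ := by
  rw [dot, dottedId_comp, ← dottedId_zero]
  have h : (Surface.dotted a (Pi.single x 1 + Pi.single x 1)) =
      (Surface.dotted a 0).addDots x 2 := by
    rw [Surface.addDots, ← Pi.single_add, zero_add]
  have key : ∀ (F : Surface a a) (hF : F.Generated) (_ : F = (Surface.dotted a 0).addDots x 2),
      mor R F hF = dottedId R a 0 := by
    rintro F hF rfl
    exact CategoryTheory.Quotient.sound (rel R k)
      (Rel.dot_sq (R := R) (Surface.dotted a 0) x (Surface.dotted_generated a 0) hF)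
  exact key _ _ h

theorem dot_comm (a : VTangle k) (x y : Fin a.pieces) :
    dot R a x ≫ dot R a y = dot R a y ≫ dot R a x := by
  rw [dot, dot, dottedId_comp, dottedId_comp, add_comm]

/-! ### The idempotents down and up -/

/-- The colours down and up. -/
inductive Colour
  | down
  | up
  deriving DecidableEq

instance : Fintype Colour := ⟨{.down, .up}, fun p => by cases p <;> decide⟩

/-- Exchange down and up. -/
def Colour.swap : Colour → Colour
  | down => up
  | up => down

variable [Invertible (2 : R)]

/-- The idempotent down `½(Id + dot)` resp. up `½(Id - dot)` on the piece `x`. -/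
def colour (a : VTangle k) (x : Fin a.pieces) : Colour → (obj R a ⟶ obj R a)
  | .down => (⅟2 : R) • (𝟙 _ + dot R a x)
  | .up => (⅟2 : R) • (𝟙 _ - dot R a x)

theorem colour_idem (a : VTangle k) (x : Fin a.pieces) (p : Colour) :
    colour R a x p ≫ colour R a x p = colour R a x p := by
  have h2 : ∀ f : obj R a ⟶ obj R a, (⅟2 : R) • (f + f) = f := fun f => by
    rw [← two_smul R f, smul_smul, invOf_mul_self, one_smul]
  have hd := dot_comp_self R a x
  cases p
  · have : (𝟙 (obj R a) + dot R a x) ≫ (𝟙 (obj R a) + dot R a x) =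
        (𝟙 (obj R a) + dot R a x) + (𝟙 (obj R a) + dot R a x) := by
      simp only [Preadditive.add_comp, Preadditive.comp_add, Category.id_comp, Category.comp_id, hd]
      abel
    rw [colour, Linear.smul_comp, Linear.comp_smul, this, h2]
  · have : (𝟙 (obj R a) - dot R a x) ≫ (𝟙 (obj R a) - dot R a x) =
        (𝟙 (obj R a) - dot R a x) + (𝟙 (obj R a) - dot R a x) := by
      simp only [Preadditive.sub_comp, Preadditive.comp_sub, Category.id_comp, Category.comp_id, hd]
      abel
    rw [colour, Linear.smul_comp, Linear.comp_smul, this, h2]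

theorem colour_comm (a : VTangle k) (x y : Fin a.pieces) (p q : Colour) :
    colour R a x p ≫ colour R a y q = colour R a y q ≫ colour R a x p := by
  have hd := dot_comm R a x y
  cases p <;> cases q <;>
    simp only [colour, Linear.smul_comp, Linear.comp_smul] <;> congr 2 <;>
    simp only [Preadditive.sub_comp, Preadditive.comp_sub, Preadditive.add_comp,
      Preadditive.comp_add, Category.id_comp, Category.comp_id, hd] <;> abel

/-- The object of the Karoubi envelope given by `a` with the piece `x` coloured by `p` and the
piece `y` coloured by `q`. -/
def coloured (a : VTangle k) (x y : Fin a.pieces) (p q : Colour) :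
    Idempotents.Karoubi (Cob R k) where
  X := obj R a
  p := colour R a x p ≫ colour R a y q
  idem := by
    rw [Category.assoc, ← Category.assoc (colour R a y q), colour_comm R a y x q p,
      Category.assoc, colour_idem, ← Category.assoc, colour_idem]

/-! ### The complexes of a crossing -/

/-- Formal matrices over the Karoubi envelope of the cobordism category; formal complexes over it
are the complexes `CochainComplex (KarMat R k) ℤ`. -/
abbrev KarMat (k : ℕ) := Mat_ (Idempotents.Karoubi (Cob R k))

/-- The smoothing `)(`.  The boundary points are `0, 1, 2, 3 =` NW, SW, SE, NE; the left string
is number `0` (standard orientation: downwards), the right string is number `1` (upwards). -/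
abbrev vertical : VTangle 4 where
  pieces := 2
  ends := ![0, 0, 1, 1]
  card_ends := by decide

/-- The other smoothing, with the same boundary points.  The bottom string is number `0` (standard
orientation: to the right), the top string is number `1` (to the left). -/
abbrev horizontal : VTangle 4 where
  pieces := 2
  ends := ![1, 0, 0, 1]
  card_ends := by decide

/-- The left string. -/
abbrev left : Fin vertical.pieces := (0 : Fin 2)

/-- The right string. -/
abbrev right : Fin vertical.pieces := (1 : Fin 2)

/-- The bottom string. -/
abbrev bottom : Fin horizontal.pieces := (0 : Fin 2)

/-- The top string. -/
abbrev top : Fin horizontal.pieces := (1 : Fin 2)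

/-- The saddle between two pairs of strings with indicator `+1`, i.e. a disc, with prescribed gluing
numbers. -/
abbrev saddleSurface (a b : VTangle 4) (s : Fin a.pieces → ℤˣ) (t : Fin b.pieces → ℤˣ) :
    Surface a b where
  comps := 1
  pos _ := 0
  seam _ := rfl
  euler _ := 1
  sign := Sum.elim s t
  ind _ := 1
  dots _ := 0

theorem saddle_vh_generated (s : Fin vertical.pieces → ℤˣ) (t : Fin horizontal.pieces → ℤˣ) :
    (saddleSurface vertical horizontal s t).Generated := by
  refine .elementary _ fun z => ?_
  have hz : ∀ P : Prop, P → ((0 : Fin 1) = z ↔ P) := fun P hP =>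
    iff_of_true (Subsingleton.elim (α := Fin 1) _ _) hP
  refine .saddle left right bottom top (by decide) (by decide) (by decide) (by decide)
    (by decide) (by decide) ⟨1, 0, by decide⟩ ?_ ?_ rfl
  · ext x; exact hz _ ((show ∀ x : Fin 2, x ∈ ({0, 1} : Set (Fin 2)) by decide) x)
  · ext x; exact hz _ ((show ∀ x : Fin 2, x ∈ ({0, 1} : Set (Fin 2)) by decide) x)

theorem saddle_hv_generated (s : Fin horizontal.pieces → ℤˣ) (t : Fin vertical.pieces → ℤˣ) :
    (saddleSurface horizontal vertical s t).Generated := by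
  refine .elementary _ fun z => ?_
  have hz : ∀ P : Prop, P → ((0 : Fin 1) = z ↔ P) := fun P hP =>
    iff_of_true (Subsingleton.elim (α := Fin 1) _ _) hP
  refine .saddle bottom top left right (by decide) (by decide) (by decide) (by decide)
    (by decide) (by decide) ⟨1, 2, by decide⟩ ?_ ?_ rfl
  · ext x; exact hz _ ((show ∀ x : Fin 2, x ∈ ({0, 1} : Set (Fin 2)) by decide) x)
  · ext x; exact hz _ ((show ∀ x : Fin 2, x ∈ ({0, 1} : Set (Fin 2)) by decide) x)

/-- The inclusion of the cobordism category into `KarMat`: `X` is sent to `(X, Id)`. -/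
abbrev incl (k : ℕ) : Cob R k ⥤ KarMat R k :=
  Idempotents.toKaroubi (Cob R k) ⋙ Mat_.embedding (Idempotents.Karoubi (Cob R k))

/-- The saddle `S(1)` from `)(` to the other smoothing, with the gluing numbers `l r` of the left
and right string and `b t` of the bottom and top string. -/
def saddleVH (l r b t : ℤˣ) : obj R vertical ⟶ obj R horizontal :=
  mor R (saddleSurface vertical horizontal ![l, r] ![b, t]) (saddle_vh_generated _ _)

/-- The saddle `S(1)` in the other direction. -/
def saddleHV (b t l r : ℤˣ) : obj R horizontal ⟶ obj R vertical :=
  mor R (saddleSurface horizontal vertical ![b, t] ![l, r]) (saddle_hv_generated _ _)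

open HomologicalComplex in
/-- The complex of a positive crossing, in degrees `0` and `1`. -/
def positiveCrossing (l r b t : ℤˣ) : CochainComplex (KarMat R 4) ℤ :=
  double ((incl R 4).map (saddleVH R l r b t))
    (show (ComplexShape.up ℤ).Rel 0 1 by simp)

open HomologicalComplex in
/-- The complex of a negative crossing, in degrees `-1` and `0`. -/
def negativeCrossing (b t l r : ℤˣ) : CochainComplex (KarMat R 4) ℤ :=
  double ((incl R 4).map (saddleHV R b t l r))
    (show (ComplexShape.up ℤ).Rel (-1) 0 by simp)

/-- The colour of the second string in a surviving colouring, when the first string has colour `p`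
and the two strings have gluing numbers `s` and `t`: the colours differ if the gluing numbers
are equal, and agree if the gluing numbers are different. -/
def survivor (s t : ℤˣ) (p : Colour) : Colour := if s = t then p.swap else p

/-- The direct sum of the two surviving colourings of `)(`: `du ⊕ ud` if `l = r`, and
`dd ⊕ uu` otherwise. -/
abbrev verticalSum (l r : ℤˣ) : KarMat R 4 where
  ι := Colour
  X p := coloured R vertical left right p (survivor l r p)

/-- The direct sum of the two surviving colourings of the other smoothing: `du ⊕ ud` if `b = t`, and
`dd ⊕ uu` otherwise. -/
def horizontalSum (b t : ℤˣ) : KarMat R 4 where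
  ι := Colour
  X p := coloured R horizontal bottom top p (survivor b t p)

end VKh

end

noncomputable section

/-! The saddle of a crossing is not invertible, but it has a quasi-inverse, and a two-term complex
whose differential has one is determined up to homotopy by two split idempotents.

Let `S` be the saddle with indicator `+1` from two strings `x₀`, `x₁` with gluing numbers `a₀`, `a₁`
to two strings `y₀`, `y₁` with gluing numbers `b₀`, `b₁`. A dot can be moved onto `S` from any of
these strings, at the cost of the gluing number of the string (`dot_comp_connectedSurface`,
`connectedSurface_comp_dot`), because reversing the gluing numbers of a dotted strip with indicator
`+1` changes its sign. Let `T` be the saddle in the opposite direction with the same gluing numbers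
but indicator `-1`. Then `S ≫ T` has Euler characteristic `0` and indicator `-1`, exactly as two
strips joined by a tube, and neck cutting gives `S ≫ T = a₀ x₀ + a₁ x₁`, where a string also denotes
the dot on it (`saddle_comp_saddle`). In the same way `T ≫ S = b₀ y₀ + b₁ y₁`.

Put `g = ½ a₀ (T ≫ x₀)`. Then `S ≫ g = ½(1 + a₀a₁ x₁x₀)`, `g ≫ S = ½(1 + b₀b₁ y₁y₀)` and `S ≫ g ≫ S
= S`. Hence `-g` contracts the complex onto the images of the idempotents `1 - S ≫ g` and `1 - g ≫
S`, with zero differential (`doubleEquivZero`). A dot acts as `+1` on down and as `-1` on up, so the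
first idempotent projects onto the colourings whose two dot eigenvalues have product `-a₀a₁`:
different colours for equal gluing numbers, equal colours otherwise (`sum_survivors`). The same
holds for the second one. -/

namespace VKh

/-! ### Two-term complexes and differentials with a quasi-inverse -/

section Double

open HomologicalComplex

variable {C : Type*} [Category* C] [Preadditive C] [HasZeroObject C]
  {ι : Type*} {c : ComplexShape ι} {i₀ i₁ : ι} (hi : c.Rel i₀ i₁) (hne : i₀ ≠ i₁)

/-- A morphism of two-term complexes from a commutative square. -/
def doubleMap {X₀ X₁ Y₀ Y₁ : C} {f : X₀ ⟶ X₁} {g : Y₀ ⟶ Y₁} (φ₀ : X₀ ⟶ Y₀) (φ₁ : X₁ ⟶ Y₁)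
    (comm : φ₀ ≫ g = f ≫ φ₁) : double f hi ⟶ double g hi :=
  mkHomFromDouble hi hne (φ₀ ≫ (doubleXIso₀ g hi).inv) (φ₁ ≫ (doubleXIso₁ g hi hne).inv)
    (by simp [double_d g hi hne, reassoc_of% comm])
    (fun k _ => by rw [double_d_eq_zero₀ g hi _ _ hne.symm, comp_zero])

open scoped Classical in
/-- A morphism `X₁ ⟶ Y₀`, extended by zero to a family of maps between two-term complexes. -/
def doubleDiag {X₀ X₁ Y₀ Y₁ : C} (f : X₀ ⟶ X₁) (g : Y₀ ⟶ Y₁) (h : X₁ ⟶ Y₀) (i j : ι) :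
    (double f hi).X i ⟶ (double g hi).X j :=
  if e : i = i₁ ∧ j = i₀ then
    eqToHom (by rw [e.1]) ≫ (doubleXIso₁ f hi hne).hom ≫ h ≫ (doubleXIso₀ g hi).inv ≫
      eqToHom (by rw [e.2])
  else 0

/-- Two morphisms out of a two-term complex are homotopic if they differ by a diagonal map. -/
def doubleHomotopy {X₀ X₁ Y₀ Y₁ : C} {f : X₀ ⟶ X₁} {g : Y₀ ⟶ Y₁} (φ₀ ψ₀ : X₀ ⟶ Y₀)
    (φ₁ ψ₁ : X₁ ⟶ Y₁) (hφ : φ₀ ≫ g = f ≫ φ₁) (hψ : ψ₀ ≫ g = f ≫ ψ₁) (h : X₁ ⟶ Y₀)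
    (h₀ : φ₀ = f ≫ h + ψ₀) (h₁ : φ₁ = h ≫ g + ψ₁) :
    Homotopy (doubleMap hi hne φ₀ φ₁ hφ) (doubleMap hi hne ψ₀ ψ₁ hψ) where
  hom := doubleDiag hi hne f g h
  zero i j hij := dif_neg (by rintro ⟨rfl, rfl⟩; exact hij hi)
  comm k := by
    by_cases hk₀ : k = i₀
    · subst hk₀
      -- The diagonal map is nonzero only out of degree `i₁`, so in degree `i₀` only the term `f ≫
      -- h` remains.
      have hz : prevD k (doubleDiag hi hne f g h) = 0 := by
        change doubleDiag hi hne f g h _ _ ≫ _ = 0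
        rw [doubleDiag, dif_neg (fun e => hne e.1), zero_comp]
      rw [hz, dNext_eq _ hi, doubleDiag, dif_pos ⟨rfl, rfl⟩]
      simp [doubleMap, double_d f hi hne, h₀]
    · by_cases hk₁ : k = i₁
      · subst hk₁
        have hz : dNext k (doubleDiag hi hne f g h) = 0 := by
          change _ ≫ doubleDiag hi hne f g h _ _ = 0
          rw [doubleDiag, dif_neg (fun e => hne e.2.symm), comp_zero]
        rw [hz, prevD_eq _ hi, doubleDiag, dif_pos ⟨rfl, rfl⟩]
        simp [doubleMap, double_d g hi hne, h₁]
      · exact (isZero_double_X f hi k hk₀ hk₁).eq_of_src _ _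

lemma doubleMap_comp {X₀ X₁ Y₀ Y₁ Z₀ Z₁ : C} {f : X₀ ⟶ X₁} {g : Y₀ ⟶ Y₁} {h : Z₀ ⟶ Z₁}
    (φ₀ : X₀ ⟶ Y₀) (φ₁ : X₁ ⟶ Y₁) (hφ : φ₀ ≫ g = f ≫ φ₁)
    (ψ₀ : Y₀ ⟶ Z₀) (ψ₁ : Y₁ ⟶ Z₁) (hψ : ψ₀ ≫ h = g ≫ ψ₁) :
    doubleMap hi hne φ₀ φ₁ hφ ≫ doubleMap hi hne ψ₀ ψ₁ hψ =
      doubleMap hi hne (φ₀ ≫ ψ₀) (φ₁ ≫ ψ₁)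
        (by rw [Category.assoc, hψ, reassoc_of% hφ]) := by
  ext <;> simp [doubleMap]

lemma doubleMap_id {X₀ X₁ : C} (f : X₀ ⟶ X₁) :
    doubleMap hi hne (𝟙 X₀) (𝟙 X₁) (by simp) = 𝟙 (double f hi) := by
  ext <;> simp [doubleMap]

/-- If `g` is a quasi-inverse of `f` and the idempotents `1 - fg` and `1 - gf` split as `A` and `B`,
then the two-term complex of `f` is homotopy equivalent to the zero map from `A` to `B`. -/
def doubleEquivZero {X Y A B : C} (f : X ⟶ Y) (g : Y ⟶ X) (hf : f ≫ g ≫ f = f)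
    (i : A ⟶ X) (π : X ⟶ A) (hi' : i ≫ π = 𝟙 A) (hπ : π ≫ i = 𝟙 X - f ≫ g)
    (j : B ⟶ Y) (ρ : Y ⟶ B) (hj : j ≫ ρ = 𝟙 B) (hρ : ρ ≫ j = 𝟙 Y - g ≫ f) :
    HomotopyEquiv (double f hi) (double (0 : A ⟶ B) hi) where
  hom := doubleMap hi hne π ρ <| by
    -- This is `f ≫ (1 - g ≫ f) = 0`. Since `j` is split mono, it forces `f ≫ ρ = 0`. For the
    -- inclusions below, `π` is split epi and the argument is dual.
    have : f ≫ ρ ≫ j = 0 := by rw [hρ]; simp [hf]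
    rw [comp_zero, ← Category.comp_id ρ, ← hj, reassoc_of% this, zero_comp]
  inv := doubleMap hi hne i j <| by
    have : π ≫ i ≫ f = 0 := by rw [reassoc_of% hπ]; simp [hf]
    rw [zero_comp, ← Category.id_comp i, ← hi', Category.assoc, Category.assoc, this, comp_zero]
  homotopyHomInvId := by
    -- The homotopy is `-g`: the composites `π ≫ i` and `ρ ≫ j` differ from the identities by `-f ≫
    -- g` and `-g ≫ f`.
    refine (Homotopy.ofEq (doubleMap_comp ..)).trans
      ((doubleHomotopy hi hne _ (𝟙 X) _ (𝟙 Y) _ (by simp) (-g) ?_ ?_).trans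
        (Homotopy.ofEq (doubleMap_id hi hne f)))
    · rw [hπ, Preadditive.comp_neg]; abel
    · rw [hρ, Preadditive.neg_comp]; abel
  homotopyInvHomId := by
    refine (Homotopy.ofEq (doubleMap_comp ..)).trans (Homotopy.ofEq ?_)
    rw [← doubleMap_id hi hne]
    congr 1

end Double

/-! ### Gluing numbers, gluings and tubes -/

section Surfaces

open Surface

variable {k : ℕ} (R : Type*) [CommRing R]

variable {a b c : VTangle k}

lemma mor_comp_mor (F : Surface a b) (G : Surface b c) (H : Surface a c)
    (hF : F.Generated) (hG : G.Generated) (hH : H.Generated) (p : Fin F.comps → Fin H.comps)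
    (q : Fin G.comps → Fin H.comps) (h : IsGluing F G H p q) :
    mor R F hF ≫ mor R G hG = mor R H hH :=
  ((CategoryTheory.Quotient.functor (rel R k)).map_comp _ _).symm.trans
    (CategoryTheory.Quotient.sound (rel R k) (Rel.glue _ _ _ _ _ _ _ _ h))

lemma mor_flip (F : Surface a b) (z : Fin F.comps) (hF : F.Generated)
    (hF' : (F.flip z).Generated) :
    mor R F hF = (((F.ind z * (-1) ^ F.dots z : ℤˣ) : ℤ) : R) • mor R (F.flip z) hF' :=
  (CategoryTheory.Quotient.sound (rel R k) (Rel.flip F z hF hF')).trans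
    ((CategoryTheory.Quotient.functor (rel R k)).map_smul _ _)

lemma mor_neck (F G : Surface a b) (z₁ z₂ : Fin G.comps)
    (p : Fin G.comps → Fin F.comps) (h : IsTube F G z₁ z₂ p) (hF : F.Generated)
    (h₁ : (G.addDots z₁ 1).Generated) (h₂ : (G.addDots z₂ 1).Generated) :
    mor R F hF = mor R (G.addDots z₁ 1) h₁ + mor R (G.addDots z₂ 1) h₂ :=
  (CategoryTheory.Quotient.sound (rel R k) (Rel.neck F G z₁ z₂ p h hF h₁ h₂)).trans
    (Functor.map_add _)

lemma mor_congr {F G : Surface a b} (h : F = G) (hF : F.Generated) (hG : G.Generated) :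
    mor R F hF = mor R G hG := by
  subst h; rfl

/-- The identity cobordism with `n x` dots on the piece `x`, and gluing number `s x` on both
boundary pieces of the component of `x`. -/
abbrev signedDotted (a : VTangle k) (s : Fin a.pieces → ℤˣ) (n : Fin a.pieces → ℕ) :
    Surface a a :=
  { dotted a n with sign := Sum.elim s s }

lemma signedDotted_generated (a : VTangle k) (s : Fin a.pieces → ℤˣ) (n : Fin a.pieces → ℕ) :
    (signedDotted a s n).Generated := by
  refine .elementary _ fun z => ?_
  have ht : (signedDotted a s n).top z = {z} := rfl
  have hb : (signedDotted a s n).bot z = {z} := rfl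
  by_cases hz : a.IsString z
  · exact .strip z z hz hz ht hb (if_pos hz)
  · exact .cylinder z z hz hz ht hb (if_neg hz) rfl

lemma signedDotted_flip (a : VTangle k) (s : Fin a.pieces → ℤˣ) (n : Fin a.pieces → ℕ)
    (z : Fin a.pieces) :
    (signedDotted a s n).flip z = signedDotted a (Function.update s z (-s z)) n := by
  have : (fun x : Fin a.pieces ⊕ Fin a.pieces =>
      if (Sum.elim id id x : Fin a.pieces) = z then - (Sum.elim s s x : ℤˣ) else Sum.elim s s x) =
      Sum.elim (Function.update s z (-s z)) (Function.update s z (-s z)) := by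
    ext x
    rcases x with x | x <;> by_cases h : x = z <;> simp [h]
  simp only [Surface.flip, signedDotted, dotted, this]

/-- The components of a dotted identity have indicator `+1`, so a reversal costs only `-1` per dot.
The unit `s z * e` records whether the component of `z` is reversed. -/
lemma mor_signedDotted_update (a : VTangle k) (s : Fin a.pieces → ℤˣ) (n : Fin a.pieces → ℕ)
    (z : Fin a.pieces) (e : ℤˣ) :
    mor R (signedDotted a (Function.update s z e) n) (signedDotted_generated a _ n) =
      ((((s z * e) ^ n z : ℤˣ) : ℤ) : R) • mor R (signedDotted a s n)
        (signedDotted_generated a s n) := by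
  rcases Int.units_eq_one_or (s z * e) with h | h
  · obtain rfl : e = s z := by rw [← mul_left_cancel_iff (a := s z), h]; simp
    rw [h, Function.update_eq_self]
    simp
  · obtain rfl : e = - s z := by rw [← mul_left_cancel_iff (a := s z), h]; simp
    -- The flip is applied on the right-hand side; its sign meets the given one, and their product
    -- is a square.
    rw [mor_flip R (signedDotted a s n) z (signedDotted_generated a s n)
      (by rw [signedDotted_flip]; exact signedDotted_generated ..), smul_smul, h,
      mor_congr R (signedDotted_flip a s n z) _ (signedDotted_generated ..)]
    change _ = (_ * (((1 * (-1) ^ n z : ℤˣ) : ℤ) : R)) • _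
    rw [one_mul, ← Int.cast_mul, ← Units.val_mul, ← mul_pow]
    simp

/-- Removing the gluing numbers of a dotted identity. -/
lemma mor_signedDotted (a : VTangle k) (s : Fin a.pieces → ℤˣ) (n : Fin a.pieces → ℕ) :
    mor R (signedDotted a s n) (signedDotted_generated a s n) =
      (((∏ z, s z ^ n z : ℤˣ) : ℤ) : R) • dottedId R a n := by
  -- The gluing numbers are normalised to `1` one component at a time; `A` is the set of pieces
  -- still carrying their number from `s`.
  suffices H : ∀ A : Finset (Fin a.pieces),
      mor R (signedDotted a (fun z => if z ∈ A then s z else 1) n) (signedDotted_generated a _ n) =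
      (((∏ z ∈ A, s z ^ n z : ℤˣ) : ℤ) : R) • dottedId R a n by
    simpa using H Finset.univ
  intro A
  induction A using Finset.induction_on with
  | empty =>
    have : signedDotted a (fun z => if z ∈ (∅ : Finset (Fin a.pieces)) then s z else 1) n =
        dotted a n := by
      have h : (Sum.elim (fun _ => 1) (fun _ => 1) : Fin a.pieces ⊕ Fin a.pieces → ℤˣ) =
          fun _ => 1 := by ext x; cases x <;> rfl
      simp [signedDotted, h]
    rw [mor_congr R this _ (dotted_generated a n)]
    simp [dottedId]
  | insert z A hz ih =>
    have : (fun w => if w ∈ insert z A then s w else 1) =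
        Function.update (fun w => if w ∈ A then s w else 1) z (s z) := by
      ext w
      by_cases h : w = z
      · subst h; simp
      · simp [h]
    rw [mor_congr R (congrArg (fun s => signedDotted a s n) this) _ (signedDotted_generated a _ n),
      mor_signedDotted_update, ih, smul_smul, Finset.prod_insert hz, if_neg hz, one_mul,
      Units.val_mul, Int.cast_mul]

lemma mor_signedDotted_single (a : VTangle k) (s : Fin a.pieces → ℤˣ) (x : Fin a.pieces) :
    mor R (signedDotted a s (Pi.single x 1)) (signedDotted_generated a s _) =
      ((s x : ℤ) : R) • dot R a x := by
  rw [mor_signedDotted, dot, Finset.prod_eq_single x]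
  · simp
  · intro z _ hz
    simp [hz]
  · simp

/-- A connected surface with prescribed decorations. -/
abbrev connectedSurface (a b : VTangle k) (s : Fin a.pieces → ℤˣ) (t : Fin b.pieces → ℤˣ)
    (e : ℤ) (i : ℤˣ) (n : ℕ) : Surface a b where
  comps := 1
  pos _ := 0
  seam _ := rfl
  euler _ := e
  sign := Sum.elim s t
  ind _ := i
  dots _ := n

/-- Each strip or cylinder meets the connected surface along its own piece and is absorbed. The
Euler characteristics of the strips cancel against the strings of the gluing line, and the dots
accumulate. -/
lemma signedDotted_isGluing_connectedSurface (s : Fin a.pieces → ℤˣ) (t : Fin b.pieces → ℤˣ)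
    (n : Fin a.pieces → ℕ) (e : ℤ) (i : ℤˣ) (m : ℕ) :
    IsGluing (signedDotted a s n) (connectedSurface a b s t e i m)
      (connectedSurface a b s t e i (∑ x, n x + m)) (fun _ => (0 : Fin 1)) id where
  sign_match _ := rfl
  glued _ := rfl
  surj z := Or.inr ⟨z, rfl⟩
  connected := by
    have key : ∀ u : Fin a.pieces ⊕ Fin 1, Relation.EqvGen
        (Adjacent (signedDotted a s n) (connectedSurface a b s t e i m)) u (Sum.inr (0 : Fin 1)) := by
      rintro (u | u)
      · exact .rel _ _ (Adjacent.mk u)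
      · rw [Subsingleton.elim u 0]; exact .refl _
    exact fun u v _ => (key u).trans _ _ _ ((key v).symm _ _)
  pos_top _ := rfl
  pos_bot _ := rfl
  sign_top _ := rfl
  sign_bot _ := rfl
  euler z := by
    obtain rfl : z = (0 : Fin 1) := Subsingleton.elim (α := Fin 1) _ _
    change e = (∑ u : Fin a.pieces, if (0 : Fin 1) = 0 then (if a.IsString u then (1 : ℤ) else 0)
      else 0) + (∑ v : Fin 1, if v = 0 then e else 0) -
      ∑ y : Fin a.pieces, if a.IsString y ∧ (0 : Fin 1) = 0 then 1 else 0
    simp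
  ind z := by
    obtain rfl : z = (0 : Fin 1) := Subsingleton.elim (α := Fin 1) _ _
    change i = (∏ u : Fin a.pieces, if (0 : Fin 1) = 0 then 1 else 1) *
      ∏ v : Fin 1, if v = 0 then i else 1
    simp
  dots z := by
    obtain rfl : z = (0 : Fin 1) := Subsingleton.elim (α := Fin 1) _ _
    change ∑ x, n x + m = (∑ u : Fin a.pieces, if (0 : Fin 1) = 0 then n u else 0) +
      ∑ v : Fin 1, if v = 0 then m else 0
    simp

lemma connectedSurface_isGluing_signedDotted (s : Fin a.pieces → ℤˣ) (t : Fin b.pieces → ℤˣ)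
    (n : Fin b.pieces → ℕ) (e : ℤ) (i : ℤˣ) (m : ℕ) :
    IsGluing (connectedSurface a b s t e i m) (signedDotted b t n)
      (connectedSurface a b s t e i (∑ x, n x + m)) id (fun _ => (0 : Fin 1)) where
  sign_match _ := rfl
  glued _ := rfl
  surj z := Or.inl ⟨z, rfl⟩
  connected := by
    have key : ∀ u : Fin 1 ⊕ Fin b.pieces, Relation.EqvGen
        (Adjacent (connectedSurface a b s t e i m) (signedDotted b t n)) (Sum.inl (0 : Fin 1)) u := by
      rintro (u | u)
      · rw [Subsingleton.elim u 0]; exact .refl _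
      · exact .rel _ _ (Adjacent.mk u)
    exact fun u v _ => ((key u).symm _ _).trans _ _ _ (key v)
  pos_top _ := rfl
  pos_bot _ := rfl
  sign_top _ := rfl
  sign_bot _ := rfl
  euler z := by
    obtain rfl : z = (0 : Fin 1) := Subsingleton.elim (α := Fin 1) _ _
    change e = (∑ v : Fin 1, if v = 0 then e else 0) + (∑ u : Fin b.pieces, if (0 : Fin 1) = 0 then
      (if b.IsString u then (1 : ℤ) else 0) else 0) -
      ∑ y : Fin b.pieces, if b.IsString y ∧ (0 : Fin 1) = 0 then 1 else 0
    simp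
  ind z := by
    obtain rfl : z = (0 : Fin 1) := Subsingleton.elim (α := Fin 1) _ _
    change i = (∏ v : Fin 1, if v = 0 then i else 1) *
      ∏ u : Fin b.pieces, if (0 : Fin 1) = 0 then 1 else 1
    simp
  dots z := by
    obtain rfl : z = (0 : Fin 1) := Subsingleton.elim (α := Fin 1) _ _
    change ∑ x, n x + m = (∑ v : Fin 1, if v = 0 then m else 0) +
      ∑ u : Fin b.pieces, if (0 : Fin 1) = 0 then n u else 0
    simp [add_comm]

/-- The piece `y₀` shows that the middle tangle is nonempty; without it the two surfaces would stay
disjoint. -/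
lemma connectedSurface_isGluing_connectedSurface (s : Fin a.pieces → ℤˣ) (t : Fin b.pieces → ℤˣ)
    (u : Fin c.pieces → ℤˣ) (e f : ℤ) (i j : ℤˣ) (m n : ℕ) (y₀ : Fin b.pieces) :
    IsGluing (connectedSurface a b s t e i m) (connectedSurface b c t u f j n)
      (connectedSurface a c s u (e + f - ∑ y, if b.IsString y then 1 else 0) (i * j) (m + n))
      id id where
  sign_match _ := rfl
  glued _ := rfl
  surj z := Or.inl ⟨z, rfl⟩
  connected := by
    have key : ∀ v : Fin 1 ⊕ Fin 1, Relation.EqvGen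
        (Adjacent (connectedSurface a b s t e i m) (connectedSurface b c t u f j n))
          (Sum.inl (0 : Fin 1)) v := by
      rintro (v | v)
      · rw [Subsingleton.elim v 0]; exact .refl _
      · rw [Subsingleton.elim v 0]; exact .rel _ _ (Adjacent.mk y₀)
    exact fun v w _ => ((key v).symm _ _).trans _ _ _ (key w)
  pos_top _ := rfl
  pos_bot _ := rfl
  sign_top _ := rfl
  sign_bot _ := rfl
  euler z := by
    obtain rfl : z = (0 : Fin 1) := Subsingleton.elim (α := Fin 1) _ _
    change (e + f - ∑ y, if b.IsString y then 1 else 0) = (∑ v : Fin 1, if v = 0 then e else 0) +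
      (∑ v : Fin 1, if v = 0 then f else 0) -
      ∑ y : Fin b.pieces, if b.IsString y ∧ (0 : Fin 1) = 0 then 1 else 0
    simp
  ind z := by
    obtain rfl : z = (0 : Fin 1) := Subsingleton.elim (α := Fin 1) _ _
    change i * j = (∏ v : Fin 1, if v = 0 then i else 1) * ∏ v : Fin 1, if v = 0 then j else 1
    simp
  dots z := by
    obtain rfl : z = (0 : Fin 1) := Subsingleton.elim (α := Fin 1) _ _
    change m + n = (∑ v : Fin 1, if v = 0 then m else 0) + ∑ v : Fin 1, if v = 0 then n else 0
    simp

/-- The strips over two strings, connected by a tube. -/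
lemma connectedSurface_isTube (s : Fin a.pieces → ℤˣ) (x y : Fin a.pieces) (hxy : x ≠ y)
    (hcov : ∀ z, z = x ∨ z = y) (hx : a.IsString x) (hy : a.IsString y) :
    IsTube (connectedSurface a a s s 0 (-1) 0) (signedDotted a s 0) x y (fun _ => (0 : Fin 1)) where
  ne := hxy
  surj z := ⟨x, Subsingleton.elim (α := Fin 1) _ _⟩
  fibre u v := by
    rcases hcov u with rfl | rfl <;> rcases hcov v with rfl | rfl <;> simp
  pos _ := rfl
  sign _ := rfl
  euler := by simp [hx, hy]
  ind := by simp
  dots := by simp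
  euler_other u h h' := by rcases hcov u with rfl | rfl <;> contradiction
  ind_other u h h' := by rcases hcov u with rfl | rfl <;> contradiction
  dots_other u h h' := by rcases hcov u with rfl | rfl <;> contradiction

end Surfaces

/-! ### Dots on saddles and composites of saddles -/

section Saddles

open Surface

variable {k : ℕ} (R : Type*) [CommRing R]

variable {a b : VTangle k}

/-- The dotted identity has gluing numbers `1`, which need not match `s`. Changing all of them to
`s` costs only `s x`, since undotted components are reversed for free; then the surfaces can be
glued. -/
lemma dot_comp_connectedSurface (s : Fin a.pieces → ℤˣ) (t : Fin b.pieces → ℤˣ) (e : ℤ) (i : ℤˣ)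
    (m : ℕ) (h : (connectedSurface a b s t e i m).Generated)
    (h' : (connectedSurface a b s t e i (1 + m)).Generated) (x : Fin a.pieces) :
    dot R a x ≫ mor R (connectedSurface a b s t e i m) h =
      ((s x : ℤ) : R) • mor R (connectedSurface a b s t e i (1 + m)) h' := by
  have hs : ((s x : ℤ) : R) * ((s x : ℤ) : R) = 1 := by
    rw [← Int.cast_mul, ← Units.val_mul]; simp
  have hd : dot R a x = ((s x : ℤ) : R) • mor R (signedDotted a s (Pi.single x 1))
      (signedDotted_generated a s _) := by
    rw [mor_signedDotted_single, smul_smul, hs, one_smul]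
  have hg := signedDotted_isGluing_connectedSurface (b := b) s t (Pi.single x 1) e i m
  rw [Finset.sum_pi_single' x 1 Finset.univ, if_pos (Finset.mem_univ _)] at hg
  rw [hd, Linear.smul_comp, mor_comp_mor R _ _ _ _ _ h' _ _ hg]

lemma connectedSurface_comp_dot (s : Fin a.pieces → ℤˣ) (t : Fin b.pieces → ℤˣ) (e : ℤ) (i : ℤˣ)
    (m : ℕ) (h : (connectedSurface a b s t e i m).Generated)
    (h' : (connectedSurface a b s t e i (1 + m)).Generated) (y : Fin b.pieces) :
    mor R (connectedSurface a b s t e i m) h ≫ dot R b y =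
      ((t y : ℤ) : R) • mor R (connectedSurface a b s t e i (1 + m)) h' := by
  have hs : ((t y : ℤ) : R) * ((t y : ℤ) : R) = 1 := by
    rw [← Int.cast_mul, ← Units.val_mul]; simp
  have hd : dot R b y = ((t y : ℤ) : R) • mor R (signedDotted b t (Pi.single y 1))
      (signedDotted_generated b t _) := by
    rw [mor_signedDotted_single, smul_smul, hs, one_smul]
  have hg := connectedSurface_isGluing_signedDotted (a := a) s t (Pi.single y 1) e i m
  rw [Finset.sum_pi_single' y 1 Finset.univ, if_pos (Finset.mem_univ _)] at hg
  rw [hd, Linear.comp_smul, mor_comp_mor R _ _ _ _ _ h' _ _ hg]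

/-- Composing two saddles whose indicators have product `-1` gives a tube between two strips. -/
lemma saddle_comp_saddle (s : Fin a.pieces → ℤˣ) (t : Fin b.pieces → ℤˣ) (i j : ℤˣ)
    (hij : i * j = -1) (h : (connectedSurface a b s t 1 i 0).Generated)
    (h' : (connectedSurface b a t s 1 j 0).Generated) (x y : Fin a.pieces) (hxy : x ≠ y)
    (hcov : ∀ z, z = x ∨ z = y) (hx : a.IsString x) (hy : a.IsString y)
    (hb : (∑ y, if b.IsString y then 1 else 0 : ℤ) = 2) (y₀ : Fin b.pieces) :
    mor R (connectedSurface a b s t 1 i 0) h ≫ mor R (connectedSurface b a t s 1 j 0) h' =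
      ((s x : ℤ) : R) • dot R a x + ((s y : ℤ) : R) • dot R a y := by
  have hg := connectedSurface_isGluing_connectedSurface (a := a) (b := b) (c := a)
    s t s 1 1 i j 0 0 y₀
  -- Two discs glued along two strings have Euler characteristic `0`. A tube between two strips of
  -- indicator `+1` has indicator `-1`, whence the condition on `i * j`.
  rw [hb, hij, show (1 + 1 - 2 : ℤ) = 0 from rfl, add_zero] at hg
  have key : ∀ z, (signedDotted a s 0).addDots z 1 = signedDotted a s (Pi.single z 1) := fun z => by
    simp [addDots]
  have hgen : ∀ z, ((signedDotted a s 0).addDots z 1).Generated := fun z => by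
    rw [key]; exact signedDotted_generated ..
  rw [mor_comp_mor R _ _ _ _ _ (.glue _ _ _ h h' _ _ hg) _ _ hg,
    mor_neck R _ (signedDotted a s 0) x y _ (connectedSurface_isTube s x y hxy hcov hx hy) _ (hgen x) (hgen y),
    mor_congr R (key x) _ (signedDotted_generated ..),
    mor_congr R (key y) _ (signedDotted_generated ..),
    mor_signedDotted_single, mor_signedDotted_single]

end Saddles

/-! ### The surviving colourings as the splitting of an idempotent -/

section Survivors

variable {k : ℕ} (R : Type*) [CommRing R] [Invertible (2 : R)]

lemma colour_swap_orthogonal (a : VTangle k) (x : Fin a.pieces) {p q : Colour} (h : p ≠ q) :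
    colour R a x p ≫ colour R a x q = 0 := by
  have hd := dot_comp_self R a x
  cases p <;> cases q <;> first | exact absurd rfl h | skip
  all_goals
    simp only [colour, Linear.smul_comp, Linear.comp_smul, Preadditive.sub_comp,
      Preadditive.comp_sub, Preadditive.add_comp, Preadditive.comp_add, Category.id_comp,
      Category.comp_id, hd, smul_add, smul_sub, smul_smul]
    abel

lemma coloured_p_comp (a : VTangle k) (x y : Fin a.pieces) (p q p' q' : Colour) :
    (coloured R a x y p q).p ≫ (coloured R a x y p' q').p =
      (colour R a x p ≫ colour R a x p') ≫ colour R a y q ≫ colour R a y q' := by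
  simp only [coloured, Category.assoc]
  rw [← Category.assoc (colour R a y q), colour_comm R a y x q p']
  simp only [Category.assoc]

lemma coloured_p_orthogonal (a : VTangle k) (x y : Fin a.pieces) {p p' : Colour} (q q' : Colour)
    (h : p ≠ p') : (coloured R a x y p q).p ≫ (coloured R a x y p' q').p = 0 := by
  rw [coloured_p_comp, colour_swap_orthogonal R a x h, zero_comp]; rfl

/-- The direct sum of the surviving colourings of the pieces `x` and `y` of `a`. -/
abbrev survivorSum (a : VTangle k) (x y : Fin a.pieces) (s t : ℤˣ) : KarMat R k where
  ι := Colour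
  X p := coloured R a x y p (survivor s t p)

/-- The inclusion of the surviving colourings. -/
def survivorIncl (a : VTangle k) (x y : Fin a.pieces) (s t : ℤˣ) :
    survivorSum R a x y s t ⟶ (incl R k).obj (obj R a) :=
  fun p _ => (coloured R a x y p (survivor s t p)).decompId_i

/-- The projection to the surviving colourings. -/
def survivorProj (a : VTangle k) (x y : Fin a.pieces) (s t : ℤˣ) :
    (incl R k).obj (obj R a) ⟶ survivorSum R a x y s t :=
  fun _ p => (coloured R a x y p (survivor s t p)).decompId_p

lemma survivorIncl_comp_survivorProj (a : VTangle k) (x y : Fin a.pieces) (s t : ℤˣ) :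
    survivorIncl R a x y s t ≫ survivorProj R a x y s t = 𝟙 _ := by
  apply Mat_.hom_ext
  intro p q
  rw [Mat_.comp_apply]
  refine (Fintype.sum_unique fun j : PUnit =>
    survivorIncl R a x y s t p j ≫ survivorProj R a x y s t j q).trans ?_
  by_cases h : p = q
  · subst h
    rw [Mat_.id_apply_self]
    exact (Idempotents.Karoubi.decompId _).symm
  · rw [Mat_.id_apply_of_ne _ _ _ h]
    apply Idempotents.Karoubi.hom_ext
    -- Different indices already give `x` different colours, so the colour of `y` plays no role.
    exact coloured_p_orthogonal R a x y _ _ h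

/-- Both sides are `½(1 - s t · dot_x dot_y)`: in the sum over the two colourings the terms with a
single dot cancel. -/
lemma sum_survivors (a : VTangle k) (x y : Fin a.pieces) (s t : ℤˣ) :
    ∑ p, colour R a x p ≫ colour R a y (survivor s t p) =
      𝟙 (obj R a) - (⅟2 : R) • (𝟙 _ + (((s : ℤ) : R) * ((t : ℤ) : R)) • (dot R a y ≫ dot R a x)) := by
  have h2 : (⅟2 : R) * 2 = 1 := invOf_mul_self _
  have hs : ∀ f : Colour → (obj R a ⟶ obj R a), ∑ p, f p = f .down + f .up := fun f =>
    Finset.sum_pair (by decide)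
  have hne : (1 : ℤˣ) ≠ -1 := by decide
  rw [hs, dot_comm R a y x]
  rcases Int.units_eq_one_or s with rfl | rfl <;> rcases Int.units_eq_one_or t with rfl | rfl
  all_goals
    simp only [survivor, hne, hne.symm, if_true, if_false,
      Colour.swap, colour, Linear.smul_comp, Linear.comp_smul, Preadditive.sub_comp,
      Preadditive.comp_sub, Preadditive.add_comp, Preadditive.comp_add, Category.id_comp,
      Category.comp_id, Units.val_one, Units.val_neg, Int.cast_one, Int.cast_neg]
    generalize (⅟2 : R) = h at *
    -- The remaining scalar identities follow from `h * 2 = 1`; for instance `2h² = 1 - h` is `(h +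
    -- 1)(2h - 1) = 0`.
    match_scalars <;> first
      | ring1
      | linear_combination (h + 1) * h2
      | linear_combination h * h2
      | linear_combination (-h) * h2

lemma survivorProj_comp_survivorIncl (a : VTangle k) (x y : Fin a.pieces) (s t : ℤˣ) :
    survivorProj R a x y s t ≫ survivorIncl R a x y s t = 𝟙 _ -
      (incl R k).map
        ((⅟2 : R) • (𝟙 _ + (((s : ℤ) : R) * ((t : ℤ) : R)) • (dot R a y ≫ dot R a x))) := by
  rw [← (incl R k).map_id, ← Functor.map_sub, ← sum_survivors]
  apply Mat_.hom_ext
  intro i j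
  apply Idempotents.Karoubi.hom_ext
  rw [Mat_.comp_apply]
  refine (Idempotents.Karoubi.sum_hom _ _).trans ?_
  have : ∀ p : Colour, (survivorProj R a x y s t i p ≫ survivorIncl R a x y s t p j).f =
      colour R a x p ≫ colour R a y (survivor s t p) := fun p => (coloured R a x y p _).idem
  exact Finset.sum_congr rfl fun p _ => this p

end Survivors

/-! ### The algebra of the quasi-inverse of a saddle -/

section QuasiInverse

variable {R : Type*} [CommRing R] [Invertible (2 : R)] {C : Type*} [Category* C] [Preadditive C]
  [Linear R C] {A B : C} {x₀ x₁ : A ⟶ A} {y₀ y₁ : B ⟶ B} {S S' : A ⟶ B} {T : B ⟶ A}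
  {a₀ a₁ b₀ b₁ : R}

lemma comp_quasiInverse (hx : x₀ ≫ x₀ = 𝟙 A) (ha : a₀ * a₀ = 1)
    (hST : S ≫ T = a₀ • x₀ + a₁ • x₁) :
    S ≫ ((⅟2 * a₀) • (T ≫ x₀)) = (⅟2 : R) • (𝟙 A + (a₀ * a₁) • (x₁ ≫ x₀)) := by
  rw [Linear.comp_smul, reassoc_of% hST]
  simp only [Preadditive.add_comp, Linear.smul_comp, hx, smul_add, smul_smul, mul_assoc, ha,
    mul_one]

/-- The dot `x₀` is carried through the saddle to become `y₀`, so that `T ≫ x₀ ≫ S` turns into `a₀b₀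
(T ≫ S ≫ y₀)`. Thus one map `g`, built from a dot on `A`, serves on both sides. -/
lemma quasiInverse_comp (hy : y₀ ≫ y₀ = 𝟙 B) (ha : a₀ * a₀ = 1) (hb : b₀ * b₀ = 1)
    (hxS : x₀ ≫ S = a₀ • S') (hSy : S ≫ y₀ = b₀ • S')
    (hTS : T ≫ S = b₀ • y₀ + b₁ • y₁) :
    ((⅟2 * a₀) • (T ≫ x₀)) ≫ S = (⅟2 : R) • (𝟙 B + (b₀ * b₁) • (y₁ ≫ y₀)) := by
  have hS' : S' = b₀ • (S ≫ y₀) := by rw [hSy, smul_smul, hb, one_smul]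
  have h₀ : ⅟2 * a₀ * (a₀ * (b₀ * b₀)) = (⅟2 : R) := by
    rw [hb, mul_one, mul_assoc, ha, mul_one]
  have h₁ : ⅟2 * a₀ * (a₀ * (b₀ * b₁)) = (⅟2 : R) * (b₀ * b₁) := by
    rw [← mul_assoc _ a₀, mul_assoc _ a₀ a₀, ha, mul_one]
  rw [Linear.smul_comp, Category.assoc, hxS, hS', Linear.comp_smul, Linear.comp_smul,
    ← Category.assoc, hTS]
  simp only [Preadditive.add_comp, Linear.smul_comp, hy, smul_add, smul_smul, h₀, h₁]

/-- Moving both dots onto `S` makes them cancel: `x₁ ≫ x₀ ≫ S = a₀a₁ S`. Hence `½(1 + a₀a₁ x₁x₀)`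
fixes `S`. -/
lemma comp_quasiInverse_comp (hx : x₀ ≫ x₀ = 𝟙 A) (ha : a₀ * a₀ = 1) (ha' : a₁ * a₁ = 1)
    (hxS : x₀ ≫ S = a₀ • S') (hxS' : x₁ ≫ S = a₁ • S') (hx' : x₁ ≫ x₁ = 𝟙 A)
    (hST : S ≫ T = a₀ • x₀ + a₁ • x₁) :
    S ≫ ((⅟2 * a₀) • (T ≫ x₀)) ≫ S = S := by
  have h : x₁ ≫ S' = a₁ • S := by
    have hS' : S' = a₁ • (x₁ ≫ S) := by rw [hxS', smul_smul, ha', one_smul]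
    rw [hS', Linear.comp_smul, reassoc_of% hx']
  rw [← Category.assoc, comp_quasiInverse hx ha hST, Linear.smul_comp, Preadditive.add_comp,
    Category.id_comp, Linear.smul_comp, Category.assoc, hxS, Linear.comp_smul, h, smul_smul,
    smul_smul, show a₀ * a₁ * a₀ * a₁ = (a₀ * a₀) * (a₁ * a₁) by ring, ha, ha', one_mul,
    one_smul, ← two_smul R S, smul_smul, invOf_mul_self, one_smul]

end QuasiInverse

/-! ### The complexes of a crossing -/

section Crossings

open Surface

variable (R : Type*) [CommRing R]

/-- A saddle between the two smoothings with arbitrary indicator. -/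
lemma connectedSurface_vh_generated (s : Fin vertical.pieces → ℤˣ)
    (t : Fin horizontal.pieces → ℤˣ) (i : ℤˣ) (n : ℕ) :
    (connectedSurface vertical horizontal s t 1 i n).Generated := by
  refine .elementary _ fun z => ?_
  have hz : ∀ P : Prop, P → ((0 : Fin 1) = z ↔ P) := fun P hP =>
    iff_of_true (Subsingleton.elim (α := Fin 1) _ _) hP
  -- A generating saddle may have either indicator and any dots. The witnesses SW and NW lie on the
  -- left string, and on the bottom and the top string respectively.
  refine .saddle left right bottom top (by decide) (by decide) (by decide) (by decide)
    (by decide) (by decide) ⟨1, 0, by decide⟩ ?_ ?_ rfl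
  · ext x; exact hz _ ((show ∀ x : Fin 2, x ∈ ({0, 1} : Set (Fin 2)) by decide) x)
  · ext x; exact hz _ ((show ∀ x : Fin 2, x ∈ ({0, 1} : Set (Fin 2)) by decide) x)

lemma connectedSurface_hv_generated (s : Fin horizontal.pieces → ℤˣ)
    (t : Fin vertical.pieces → ℤˣ) (i : ℤˣ) (n : ℕ) :
    (connectedSurface horizontal vertical s t 1 i n).Generated := by
  refine .elementary _ fun z => ?_
  have hz : ∀ P : Prop, P → ((0 : Fin 1) = z ↔ P) := fun P hP =>
    iff_of_true (Subsingleton.elim (α := Fin 1) _ _) hP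
  -- SW and SE lie on the bottom string, and on the left and the right string respectively.
  refine .saddle bottom top left right (by decide) (by decide) (by decide) (by decide)
    (by decide) (by decide) ⟨1, 2, by decide⟩ ?_ ?_ rfl
  · ext x; exact hz _ ((show ∀ x : Fin 2, x ∈ ({0, 1} : Set (Fin 2)) by decide) x)
  · ext x; exact hz _ ((show ∀ x : Fin 2, x ∈ ({0, 1} : Set (Fin 2)) by decide) x)

lemma sum_strings_vertical : (∑ y, if vertical.IsString y then 1 else 0 : ℤ) = 2 := by
  decide

lemma sum_strings_horizontal : (∑ y, if horizontal.IsString y then 1 else 0 : ℤ) = 2 := by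
  decide

variable [Invertible (2 : R)]

/-- The delooping of a saddle with indicator `+1` between two pairs of strings: up to homotopy only
the colourings on which it vanishes survive. -/
def saddleEquiv {k : ℕ} {a b : VTangle k} (s : Fin a.pieces → ℤˣ) (t : Fin b.pieces → ℤˣ)
    (hab : ∀ i n, (connectedSurface a b s t 1 i n).Generated)
    (hba : ∀ i n, (connectedSurface b a t s 1 i n).Generated)
    (x₀ x₁ : Fin a.pieces) (hx : x₀ ≠ x₁) (hx' : ∀ z, z = x₀ ∨ z = x₁)
    (y₀ y₁ : Fin b.pieces) (hy : y₀ ≠ y₁) (hy' : ∀ z, z = y₀ ∨ z = y₁)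
    (ha : ∀ x, a.IsString x) (hb : ∀ y, b.IsString y)
    (ha' : (∑ y, if a.IsString y then 1 else 0 : ℤ) = 2)
    (hb' : (∑ y, if b.IsString y then 1 else 0 : ℤ) = 2)
    {ι : Type*} {c : ComplexShape ι} {i₀ i₁ : ι} (hi : c.Rel i₀ i₁) (hne : i₀ ≠ i₁) :
    HomotopyEquiv
      (HomologicalComplex.double ((incl R k).map (mor R (connectedSurface a b s t 1 1 0) (hab 1 0)))
        hi)
      (HomologicalComplex.double (0 : survivorSum R a x₀ x₁ (s x₀) (s x₁) ⟶
        survivorSum R b y₀ y₁ (t y₀) (t y₁)) hi) := by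
  have hu : ∀ e : ℤˣ, ((e : ℤ) : R) * ((e : ℤ) : R) = 1 := fun e => by
    rw [← Int.cast_mul, ← Units.val_mul]; simp
  have hxS := fun x => dot_comp_connectedSurface R s t 1 1 0 (hab 1 0) (hab 1 (1 + 0)) x
  have hSy := fun y => connectedSurface_comp_dot R s t 1 1 0 (hab 1 0) (hab 1 (1 + 0)) y
  -- The return saddle has indicator `-1`, so that both composites are tubes.
  have hST := saddle_comp_saddle R s t 1 (-1) (by simp) (hab 1 0) (hba (-1) 0) x₀ x₁ hx hx'
    (ha _) (ha _) hb' y₀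
  have hTS := saddle_comp_saddle R t s (-1) 1 (by simp) (hba (-1) 0) (hab 1 0) y₀ y₁ hy hy'
    (hb _) (hb _) ha' x₀
  refine doubleEquivZero hi hne _ ((incl R k).map
      ((⅟2 * ((s x₀ : ℤ) : R)) • (mor R (connectedSurface b a t s 1 (-1) 0) (hba (-1) 0) ≫
        dot R a x₀))) ?_
    (survivorIncl R a x₀ x₁ (s x₀) (s x₁)) (survivorProj R a x₀ x₁ (s x₀) (s x₁))
    (survivorIncl_comp_survivorProj R a x₀ x₁ _ _) ?_
    (survivorIncl R b y₀ y₁ (t y₀) (t y₁)) (survivorProj R b y₀ y₁ (t y₀) (t y₁))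
    (survivorIncl_comp_survivorProj R b y₀ y₁ _ _) ?_
  · rw [← Functor.map_comp, ← Functor.map_comp,
      comp_quasiInverse_comp (dot_comp_self R a x₀) (hu _) (hu _) (hxS x₀) (hxS x₁)
        (dot_comp_self R a x₁) hST]
  · rw [survivorProj_comp_survivorIncl, ← Functor.map_comp,
      comp_quasiInverse (dot_comp_self R a x₀) (hu _) hST]
  · rw [survivorProj_comp_survivorIncl, ← Functor.map_comp,
      quasiInverse_comp (dot_comp_self R b y₀) (hu _) (hu _) (hxS x₀) (hSy y₀) hTS]

end Crossings

end VKh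

end

open VKh in
theorem mainTheorem7 (R : Type*) [CommRing R] [Invertible (2 : R)] (l r b t : ℤˣ) :
    Nonempty (HomotopyEquiv (positiveCrossing R l r b t)
      (HomologicalComplex.double (0 : verticalSum R l r ⟶ horizontalSum R b t)
        (show (ComplexShape.up ℤ).Rel 0 1 by simp))) ∧
    Nonempty (HomotopyEquiv (negativeCrossing R b t l r)
      (HomologicalComplex.double (0 : horizontalSum R b t ⟶ verticalSum R l r)
        (show (ComplexShape.up ℤ).Rel (-1) 0 by simp))) := by
  have hcov : ∀ z : Fin 2, z = 0 ∨ z = 1 := by decide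
  constructor
  -- The surface with parameters `1 1 0` is by definition the saddle of the crossing, and the sums
  -- of survivors are by definition `verticalSum` and `horizontalSum`.
  · exact ⟨saddleEquiv R (a := vertical) (b := horizontal) ![l, r] ![b, t]
      (connectedSurface_vh_generated _ _) (connectedSurface_hv_generated _ _)
      left right (by decide) hcov bottom top (by decide) hcov (by decide) (by decide)
      sum_strings_vertical sum_strings_horizontal _ (by decide)⟩
  · exact ⟨saddleEquiv R (a := horizontal) (b := vertical) ![b, t] ![l, r]
      (connectedSurface_hv_generated _ _) (connectedSurface_vh_generated _ _)
      bottom top (by decide) hcov left right (by decide) hcov (by decide) (by decide)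
      sum_strings_horizontal sum_strings_vertical _ (by decide)⟩
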